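/- Let $X,Y$ be nonempty finite sets and $f:X\times Y\to\{0,1\}$. Let $D(\cdot)$ denote deterministic communication complexity: the minimum depth of a two-party protocol tree (at each inner node one player sends one bit that depends on that player's own input) whose leaves are labelled by the function values. Let $C(\cdot)$ denote the minimum number of monochromatic rectangles, possibly overlapping, needed to cover all inputs of the function. Let $\mathrm{rk}(f)$ denote the rank over $\mathbb{R}$ of the $X\times Y$ matrix with entries $(-1)^{f(x,y)}$, and for $n\ge 0$ define $f^{\oplus n}:X^n\times Y^n\to\{0,1\}$ by $f^{\oplus n}(x,y)=f(x_1,y_1)\oplus\cdots\oplus f(x_n,y_n)$. There is an absolute constant $c>0$ such that for all such $X,Y,f$ and $n$, $$D(f^{\oplus n})\ \ge\ \log_2 C(f^{\oplus n}),$$ and, if $\mathrm{rk}(f)\ge 2$, $$\log_2 C(f^{\oplus n})\ \ge\ n\cdot\left(\frac{c\,D(f)}{\log_2 \mathrm{rk}(f)}-\log_2 \mathrm{rk}(f)\right).$$ -/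

import Mathlib

namespace CommComplexity

/-- A deterministic two-party protocol tree: every inner node belongs to one player, who sends one
bit depending on her or his own input, and every leaf is labelled by an output value. -/
inductive Protocol (X Y Z : Type*) where
  | leaf (z : Z) : Protocol X Y Z
  | alice (q : X → Bool) (p₀ p₁ : Protocol X Y Z) : Protocol X Y Z
  | bob (q : Y → Bool) (p₀ p₁ : Protocol X Y Z) : Protocol X Y Z

namespace Protocol

variable {X Y Z : Type*}

/-- The label of the leaf reached on the input `(x, y)`. -/
def run : Protocol X Y Z → X → Y → Z
  | leaf z, _, _ => z
  | alice q p₀ p₁, x, y => if q x then p₁.run x y else p₀.run x y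
  | bob q p₀ p₁, x, y => if q y then p₁.run x y else p₀.run x y

/-- The number of bits exchanged in the worst case, i.e. the depth of the tree. -/
def cost : Protocol X Y Z → ℕ
  | leaf _ => 0
  | alice _ p₀ p₁ => max p₀.cost p₁.cost + 1
  | bob _ p₀ p₁ => max p₀.cost p₁.cost + 1

/-- The protocol outputs `f x y` on every input `(x, y)`. -/
def Computes (p : Protocol X Y Z) (f : X → Y → Z) : Prop :=
  ∀ x y, p.run x y = f x y

end Protocol

/-- `D f`: the least worst-case number of bits of a deterministic protocol computing `f`
(for finite `X` and `Y` such a protocol always exists). -/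
noncomputable def D {X Y Z : Type*} (f : X → Y → Z) : ℕ :=
  sInf {d | ∃ p : Protocol X Y Z, p.Computes f ∧ p.cost = d}

/-- `f` is constant on the rectangle `A × B`. -/
def IsMonochromatic {X Y Z : Type*} (f : X → Y → Z) (A : Set X) (B : Set Y) : Prop :=
  ∃ z, ∀ x ∈ A, ∀ y ∈ B, f x y = z

/-- `C f`: the least number of (possibly overlapping) rectangles, each monochromatic for `f`,
that cover all of `X × Y` (for finite `X` and `Y` such a cover always exists). -/
noncomputable def C {X Y Z : Type*} (f : X → Y → Z) : ℕ :=
  sInf {k | ∃ (A : Fin k → Set X) (B : Fin k → Set Y),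
    (∀ i, IsMonochromatic f (A i) (B i)) ∧ ∀ x y, ∃ i, x ∈ A i ∧ y ∈ B i}

/-- The `n`-fold xor `f(x₁, y₁) ⊕ ⋯ ⊕ f(xₙ, yₙ)`. -/
def xorPow {X Y : Type*} (f : X → Y → Bool) (n : ℕ) (x : Fin n → X) (y : Fin n → Y) : Bool :=
  (List.ofFn fun i => f (x i) (y i)).foldr xor false

/-- The real rank of the matrix with entries `(-1) ^ f(x, y)`. -/
noncomputable def rk {X Y : Type*} [Fintype Y] (f : X → Y → Bool) : ℕ :=
  (Matrix.of fun x y => (-1 : ℝ) ^ (f x y).toNat).rank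

end CommComplexity

/-! The leaves of a protocol of depth `d` are at most `2 ^ d` monochromatic rectangles, which gives
the first bound.

For the second, suppose `2 ^ (κ * n)` monochromatic rectangles cover the xor power. Inside `A ^ n ×
B ^ n` one of them, `S × T`, has density at least `2 ^ (-κ * n)`. Fix Alice's coordinates before `i`
and Bob's after `i`: every term `j ≠ i` of the xor then depends on one player only, so `f` splits as
`u (x i) + v (y i)` on the fibres and is constant on a quarter of their product. Fibre sizes
multiply to at least `|S| * |T|`, so some `i` yields a monochromatic rectangle of density `2 ^ (-κ -
2)` in `A × B` (`exists_monochromatic_of_xorPow`).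

Such rectangles in every `A × B` give a protocol in the manner of Nisan and Wigderson: of the two
strips through the rectangle one has about half the rank, so announcing membership in it either
halves the rank or shrinks the area (`exists_protocol_of_rectRank_le`). Balancing the tree gives `D
f = O(t * (t + κ))` with `t` about `log₂ rk f`; solving for `κ` ends the proof. -/

namespace CommComplexity

open Module

/-! ### Protocol trees: leaf counts, balancing, leaf rectangles -/

namespace Protocol

variable {X Y Z : Type*}

/-- The number of leaves of a protocol tree. -/
def leaves : Protocol X Y Z → ℕ
  | leaf _ => 1
  | alice _ p₀ p₁ => p₀.leaves + p₁.leaves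
  | bob _ p₀ p₁ => p₀.leaves + p₁.leaves

theorem leaves_pos (p : Protocol X Y Z) : 0 < p.leaves := by
  induction p <;> simp only [leaves] <;> omega

theorem cost_lt_leaves (p : Protocol X Y Z) : p.cost < p.leaves := by
  induction p with
  | leaf z => simp [cost, leaves]
  | alice q p₀ p₁ h₀ h₁ =>
    have := p₀.leaves_pos
    have := p₁.leaves_pos
    simp only [cost, leaves]
    omega
  | bob q p₀ p₁ h₀ h₁ =>
    have := p₀.leaves_pos
    have := p₁.leaves_pos
    simp only [cost, leaves]
    omega

theorem leaves_le_two_pow_cost (p : Protocol X Y Z) : p.leaves ≤ 2 ^ p.cost := by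
  have key (a b c d : ℕ) (h₀ : a ≤ 2 ^ c) (h₁ : b ≤ 2 ^ d) : a + b ≤ 2 ^ (max c d + 1) := by
    have h₂ : 2 ^ c ≤ 2 ^ max c d := Nat.pow_le_pow_right (by norm_num) (le_max_left _ _)
    have h₃ : 2 ^ d ≤ 2 ^ max c d := Nat.pow_le_pow_right (by norm_num) (le_max_right _ _)
    rw [pow_succ]
    omega
  induction p with
  | leaf z => simp [cost, leaves]
  | alice q p₀ p₁ h₀ h₁ => exact key _ _ _ _ h₀ h₁
  | bob q p₀ p₁ h₀ h₁ => exact key _ _ _ _ h₀ h₁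

theorem nonempty_output (p : Protocol X Y Z) : Nonempty Z := by
  induction p with
  | leaf z => exact ⟨z⟩
  | alice _ _ _ h _ => exact h
  | bob _ _ _ h _ => exact h

/-- The protocol obtained by first applying maps to the inputs. -/
def comap {X' Y' : Type*} (g : X' → X) (h : Y' → Y) : Protocol X Y Z → Protocol X' Y' Z
  | leaf z => leaf z
  | alice q p₀ p₁ => alice (q ∘ g) (p₀.comap g h) (p₁.comap g h)
  | bob q p₀ p₁ => bob (q ∘ h) (p₀.comap g h) (p₁.comap g h)

theorem run_comap {X' Y' : Type*} (g : X' → X) (h : Y' → Y) (p : Protocol X Y Z) (x : X')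
    (y : Y') : (p.comap g h).run x y = p.run (g x) (h y) := by
  induction p with
  | leaf z => rfl
  | alice q p₀ p₁ h₀ h₁ => simp [comap, run, h₀, h₁]
  | bob q p₀ p₁ h₀ h₁ => simp [comap, run, h₀, h₁]

theorem leaves_comap {X' Y' : Type*} (g : X' → X) (h : Y' → Y) (p : Protocol X Y Z) :
    (p.comap g h).leaves = p.leaves := by
  induction p with
  | leaf z => rfl
  | alice q p₀ p₁ h₀ h₁ => simp [comap, leaves, h₀, h₁]
  | bob q p₀ p₁ h₀ h₁ => simp [comap, leaves, h₀, h₁]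

/-- A protocol tree splits into a subtree `v`, reached on a rectangle, whose number of leaves is
between `m` and `2 * m - 2`, and the rest `r`. -/
theorem exists_subprotocol {m : ℕ} (hm : 2 ≤ m) (p : Protocol X Y Z) (h : m ≤ p.leaves) :
    ∃ (a : X → Bool) (b : Y → Bool) (v r : Protocol X Y Z),
      m ≤ v.leaves ∧ v.leaves ≤ 2 * m - 2 ∧ v.leaves + r.leaves ≤ p.leaves + 1 ∧
      ∀ x y, p.run x y = if a x && b y then v.run x y else r.run x y := by
  induction p with
  | leaf z => simp only [leaves] at h; omega
  | alice q p₀ p₁ h₀ h₁ =>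
    simp only [leaves] at h ⊢
    by_cases hp₀ : m ≤ p₀.leaves
    · obtain ⟨a, b, v, r, h1, h2, h3, h4⟩ := h₀ hp₀
      refine ⟨fun x => !q x && a x, b, v, alice q r p₁, h1, h2, ?_, fun x y => ?_⟩
      · simp only [leaves]; omega
      · cases hq : q x <;> simp [run, hq, h4]
    by_cases hp₁ : m ≤ p₁.leaves
    · obtain ⟨a, b, v, r, h1, h2, h3, h4⟩ := h₁ hp₁
      refine ⟨fun x => q x && a x, b, v, alice q p₀ r, h1, h2, ?_, fun x y => ?_⟩
      · simp only [leaves]; omega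
      · cases hq : q x <;> simp [run, hq, h4]
    -- Each child has at most `m - 1` leaves, so the whole tree serves as `v`; `r` is a leaf never
    -- reached, whence the `+ 1` in the leaf count.
    obtain ⟨z⟩ := p₀.nonempty_output
    refine ⟨fun _ => true, fun _ => true, alice q p₀ p₁, leaf z, h, ?_, le_rfl, by simp⟩
    simp only [leaves]
    omega
  | bob q p₀ p₁ h₀ h₁ =>
    simp only [leaves] at h ⊢
    by_cases hp₀ : m ≤ p₀.leaves
    · obtain ⟨a, b, v, r, h1, h2, h3, h4⟩ := h₀ hp₀
      refine ⟨a, fun y => !q y && b y, v, bob q r p₁, h1, h2, ?_, fun x y => ?_⟩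
      · simp only [leaves]; omega
      · cases hq : q y <;> simp [run, hq, h4]
    by_cases hp₁ : m ≤ p₁.leaves
    · obtain ⟨a, b, v, r, h1, h2, h3, h4⟩ := h₁ hp₁
      refine ⟨a, fun y => q y && b y, v, bob q p₀ r, h1, h2, ?_, fun x y => ?_⟩
      · simp only [leaves]; omega
      · cases hq : q y <;> simp [run, hq, h4]
    obtain ⟨z⟩ := p₀.nonempty_output
    refine ⟨fun _ => true, fun _ => true, bob q p₀ p₁, leaf z, h, ?_, le_rfl, by simp⟩
    simp only [leaves]
    omega

/-- Cut out a subtree `v` so that `v` and the rest `r` each keep at most 3/4 of the leaves. Two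
bits, `a x` and `b y`, tell which of them to continue with. Trees with at most 6 leaves have depth
at most 5 already. -/
theorem exists_run_eq_of_leaves_le (j : ℕ) (p : Protocol X Y Z)
    (hp : 3 ^ j * p.leaves ≤ 6 * 4 ^ j) :
    ∃ p' : Protocol X Y Z, (∀ x y, p'.run x y = p.run x y) ∧ p'.cost ≤ 2 * j + 5 := by
  induction j generalizing p with
  | zero =>
    have := p.cost_lt_leaves
    exact ⟨p, fun _ _ => rfl, by omega⟩
  | succ j ih =>
    by_cases h6 : p.leaves ≤ 6
    · have := p.cost_lt_leaves
      exact ⟨p, fun _ _ => rfl, by omega⟩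
    have step (u : Protocol X Y Z) (hu : 4 * u.leaves ≤ 3 * p.leaves) :
        3 ^ j * u.leaves ≤ 6 * 4 ^ j := by
      have h1 := Nat.mul_le_mul_left (3 ^ j) hu
      rw [pow_succ, pow_succ] at hp
      nlinarith
    -- With this `m` both `2 * m - 2` and `p.leaves + 1 - m` are at most 3/4 of `p.leaves`; the
    -- rounding is harmless from 7 leaves on.
    obtain ⟨a, b, v, r, h1, h2, h3, h4⟩ :=
      exists_subprotocol (m := 3 * p.leaves / 8 + 1) (by omega) p (by omega)
    obtain ⟨v', hv, hvc⟩ := ih v (step v (by omega))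
    obtain ⟨r', hr, hrc⟩ := ih r (step r (by omega))
    refine ⟨alice a r' (bob b r' v'), fun x y => ?_, ?_⟩
    · cases ha : a x <;> cases hb : b y <;> simp [run, h4, ha, hb, hv, hr]
    · simp only [cost]
      omega

/-- Protocols can be balanced: the cost is at most logarithmic in the number of leaves. -/
theorem exists_run_eq_of_leaves_le_two_pow (q : ℕ) (p : Protocol X Y Z) (hp : p.leaves ≤ 2 ^ q) :
    ∃ p' : Protocol X Y Z, (∀ x y, p'.run x y = p.run x y) ∧ p'.cost ≤ 6 * q + 5 := by
  -- Three rounds pay for one factor of two, since `(4 / 3) ^ 3 > 2`.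
  obtain ⟨p', h, hc⟩ := exists_run_eq_of_leaves_le (3 * q) p (by
    calc 3 ^ (3 * q) * p.leaves ≤ 3 ^ (3 * q) * 2 ^ q := by gcongr
      _ = 54 ^ q := by rw [pow_mul, ← mul_pow]; norm_num
      _ ≤ 64 ^ q := Nat.pow_le_pow_left (by norm_num) q
      _ = 4 ^ (3 * q) := by rw [pow_mul]; norm_num
      _ ≤ 6 * 4 ^ (3 * q) := by omega)
  exact ⟨p', h, by omega⟩

theorem exists_monochromatic_cover (p : Protocol X Y Z) :
    ∃ (A : Fin p.leaves → Set X) (B : Fin p.leaves → Set Y),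
      (∀ i, IsMonochromatic p.run (A i) (B i)) ∧ ∀ x y, ∃ i, x ∈ A i ∧ y ∈ B i := by
  induction p with
  | leaf z => exact ⟨fun _ => Set.univ, fun _ => Set.univ, fun i => ⟨z, by simp [run]⟩,
      fun x y => ⟨⟨0, by simp [leaves]⟩, by simp⟩⟩
  | alice q p₀ p₁ h₀ h₁ =>
    obtain ⟨A₀, B₀, hm₀, hc₀⟩ := h₀
    obtain ⟨A₁, B₁, hm₁, hc₁⟩ := h₁
    refine ⟨Fin.append (fun i => A₀ i ∩ {x | q x = false}) (fun i => A₁ i ∩ {x | q x = true}),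
      Fin.append B₀ B₁, fun i => ?_, fun x y => ?_⟩
    · refine Fin.addCases (fun i => ?_) (fun i => ?_) i
      · obtain ⟨z, hz⟩ := hm₀ i
        refine ⟨z, fun x hx y hy => ?_⟩
        simp only [Fin.append_left, Set.mem_inter_iff, Set.mem_ofPred_eq] at hx hy
        simp [run, hx.2, hz x hx.1 y hy]
      · obtain ⟨z, hz⟩ := hm₁ i
        refine ⟨z, fun x hx y hy => ?_⟩
        simp only [Fin.append_right, Set.mem_inter_iff, Set.mem_ofPred_eq] at hx hy
        simp [run, hx.2, hz x hx.1 y hy]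
    · cases hq : q x
      · obtain ⟨i, hi⟩ := hc₀ x y
        exact ⟨Fin.castAdd _ i, by simpa [Fin.append_left, hq] using hi⟩
      · obtain ⟨i, hi⟩ := hc₁ x y
        exact ⟨Fin.natAdd _ i, by simpa [Fin.append_right, hq] using hi⟩
  | bob q p₀ p₁ h₀ h₁ =>
    obtain ⟨A₀, B₀, hm₀, hc₀⟩ := h₀
    obtain ⟨A₁, B₁, hm₁, hc₁⟩ := h₁
    refine ⟨Fin.append A₀ A₁, Fin.append (fun i => B₀ i ∩ {x | q x = false})
      (fun i => B₁ i ∩ {x | q x = true}), fun i => ?_, fun x y => ?_⟩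
    · refine Fin.addCases (fun i => ?_) (fun i => ?_) i
      · obtain ⟨z, hz⟩ := hm₀ i
        refine ⟨z, fun x hx y hy => ?_⟩
        simp only [Fin.append_left, Set.mem_inter_iff, Set.mem_ofPred_eq] at hx hy
        simp [run, hy.2, hz x hx y hy.1]
      · obtain ⟨z, hz⟩ := hm₁ i
        refine ⟨z, fun x hx y hy => ?_⟩
        simp only [Fin.append_right, Set.mem_inter_iff, Set.mem_ofPred_eq] at hx hy
        simp [run, hy.2, hz x hx y hy.1]
    · cases hq : q y
      · obtain ⟨i, hi⟩ := hc₀ x y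
        exact ⟨Fin.castAdd _ i, by simpa [Fin.append_left, hq] using hi⟩
      · obtain ⟨i, hi⟩ := hc₁ x y
        exact ⟨Fin.natAdd _ i, by simpa [Fin.append_right, hq] using hi⟩

/-- Alice's row is searched for one by one, and a single bit of Bob then settles it. This makes the
infima in `D` and `C` attained. -/
theorem exists_computes [Finite X] (f : X → Y → Bool) :
    ∃ p : Protocol X Y Bool, p.Computes f := by
  classical
  have := Fintype.ofFinite X
  suffices h : ∀ s : Finset X, ∃ p : Protocol X Y Bool, ∀ x ∈ s, ∀ y, p.run x y = f x y by
    obtain ⟨p, hp⟩ := h Finset.univ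
    exact ⟨p, fun x y => hp x (Finset.mem_univ x) y⟩
  intro s
  induction s using Finset.induction_on with
  | empty => exact ⟨leaf true, by simp⟩
  | insert a s ha ih =>
    obtain ⟨p, hp⟩ := ih
    refine ⟨alice (fun x => decide (x = a)) p (bob (f a) (leaf false) (leaf true)),
      fun x hx y => ?_⟩
    by_cases hxa : x = a
    · subst hxa
      cases h : f x y <;> simp [run, h]
    · simpa [run, hxa] using hp x (Finset.mem_of_mem_insert_of_ne hx hxa) y

end Protocol

/-! ### Attaining `D` and `C`, and signs -/

variable {X Y Z : Type*}

theorem D_le_cost {f : X → Y → Z} {p : Protocol X Y Z} (hp : p.Computes f) : D f ≤ p.cost :=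
  Nat.sInf_le ⟨p, hp, rfl⟩

theorem exists_computes_cost_eq_D [Finite X] (f : X → Y → Bool) :
    ∃ p : Protocol X Y Bool, p.Computes f ∧ p.cost = D f := by
  obtain ⟨p, hp⟩ := Protocol.exists_computes f
  exact Nat.sInf_mem (s := {d | ∃ p : Protocol X Y Bool, p.Computes f ∧ p.cost = d})
    ⟨p.cost, p, hp, rfl⟩

theorem C_le_leaves {f : X → Y → Z} {p : Protocol X Y Z} (hp : p.Computes f) :
    C f ≤ p.leaves := by
  obtain rfl : p.run = f := funext₂ hp
  exact Nat.sInf_le p.exists_monochromatic_cover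

theorem exists_cover_of_C [Finite X] (f : X → Y → Bool) :
    ∃ (A : Fin (C f) → Set X) (B : Fin (C f) → Set Y),
      (∀ i, IsMonochromatic f (A i) (B i)) ∧ ∀ x y, ∃ i, x ∈ A i ∧ y ∈ B i := by
  obtain ⟨p, hp⟩ := Protocol.exists_computes f
  obtain rfl : p.run = f := funext₂ hp
  exact Nat.sInf_mem (s := {k | ∃ (A : Fin k → Set X) (B : Fin k → Set Y),
    (∀ i, IsMonochromatic p.run (A i) (B i)) ∧ ∀ x y, ∃ i, x ∈ A i ∧ y ∈ B i})
    ⟨p.leaves, p.exists_monochromatic_cover⟩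

theorem C_le_two_pow_D [Finite X] (f : X → Y → Bool) : C f ≤ 2 ^ D f := by
  obtain ⟨p, hp, hc⟩ := exists_computes_cost_eq_D f
  rw [← hc]
  exact (C_le_leaves hp).trans p.leaves_le_two_pow_cost

/-- The sign `(-1) ^ b` of a bit. -/
def sgn (b : Bool) : ℤˣ := (-1) ^ b.toNat

theorem sgn_injective : Function.Injective sgn := by decide

theorem sgn_xor (a b : Bool) : sgn (xor a b) = sgn a * sgn b := by
  revert a b; decide

theorem sgn_xorPow (f : X → Y → Bool) {n : ℕ} (x : Fin n → X) (y : Fin n → Y) :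
    sgn (xorPow f n x y) = ∏ i, sgn (f (x i) (y i)) := by
  induction n with
  | zero => simp [xorPow, sgn]
  | succ n ih =>
    have := ih (fun i => x i.succ) (fun i => y i.succ)
    rw [Fin.prod_univ_succ, ← this, ← sgn_xor]
    simp [xorPow, List.ofFn_succ]

/-! ### Counting a set of tuples by its fibres -/

section Fibers

variable [DecidableEq X]

/-- The values of the `i`-th coordinate on the members of `S` that agree with `p` before `i`. -/
def prefixFiber {n : ℕ} (S : Finset (Fin n → X)) (i : Fin n) (p : Fin n → X) : Finset X :=
  (S.filter fun x => ∀ j < i, x j = p j).image fun x => x i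

/-- The values of the `i`-th coordinate on the members of `S` that agree with `p` after `i`. -/
def suffixFiber {n : ℕ} (S : Finset (Fin n → X)) (i : Fin n) (p : Fin n → X) : Finset X :=
  (S.filter fun x => ∀ j, i < j → x j = p j).image fun x => x i

/-- A chain rule: choosing the coordinates of a member of `S` in order, each prefix leaves at most
`M i` choices for the next one. -/
theorem card_le_prod_of_prefixFiber {n : ℕ} (S : Finset (Fin n → X)) (M : Fin n → ℕ)
    (h : ∀ i, ∀ p ∈ S, (prefixFiber S i p).card ≤ M i) : S.card ≤ ∏ i, M i := by
  induction n with
  | zero => simpa using Finset.card_le_one_of_subsingleton S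
  | succ n ih =>
    obtain rfl | ⟨p₀, hp₀⟩ := S.eq_empty_or_nonempty
    · simp
    have h0 : (S.image fun x => x 0).card ≤ M 0 := by
      refine le_trans (Finset.card_le_card ?_) (h 0 p₀ hp₀)
      intro a ha
      obtain ⟨x, hx, rfl⟩ := Finset.mem_image.1 ha
      exact Finset.mem_image.2 ⟨x, by simp [hx], rfl⟩
    have h1 (a : X) : (S.filter fun x => x 0 = a).card ≤ ∏ i : Fin n, M i.succ := by
      have hinj : Set.InjOn (Fin.tail : (Fin (n + 1) → X) → Fin n → X)
          (S.filter fun x => x 0 = a : Finset (Fin (n + 1) → X)) := by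
        intro x hx y hy hxy
        simp only [Finset.coe_filter, Set.mem_ofPred_eq] at hx hy
        rw [← Fin.cons_self_tail x, ← Fin.cons_self_tail y, hxy, hx.2, hy.2]
      rw [← Finset.card_image_of_injOn hinj]
      refine ih _ _ fun i p hp => ?_
      obtain ⟨q, hq, rfl⟩ := Finset.mem_image.1 hp
      rw [Finset.mem_filter] at hq
      refine le_trans (Finset.card_le_card ?_) (h i.succ q hq.1)
      intro b hb
      obtain ⟨x, hx, rfl⟩ := Finset.mem_image.1 hb
      obtain ⟨hx, hxp⟩ := Finset.mem_filter.1 hx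
      obtain ⟨y, hy, rfl⟩ := Finset.mem_image.1 hx
      rw [Finset.mem_filter] at hy
      refine Finset.mem_image.2 ⟨y, Finset.mem_filter.2 ⟨hy.1, fun j hj => ?_⟩, rfl⟩
      refine Fin.cases (fun _ => hy.2.trans hq.2.symm) (fun j hj => ?_) j hj
      exact hxp j (Fin.succ_lt_succ_iff.1 hj)
    rw [Fin.prod_univ_succ, Finset.card_eq_sum_card_image fun x : Fin (n + 1) → X => x 0]
    refine (Finset.sum_le_card_nsmul _ _ _ fun a _ => h1 a).trans ?_
    rw [smul_eq_mul]
    exact Nat.mul_le_mul_right _ h0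

theorem card_le_prod_of_suffixFiber {n : ℕ} (S : Finset (Fin n → X)) (M : Fin n → ℕ)
    (h : ∀ i, ∀ p ∈ S, (suffixFiber S i p).card ≤ M i) : S.card ≤ ∏ i, M i := by
  have hinj : Function.Injective fun x : Fin n → X => x ∘ Fin.rev :=
    Fin.rev_surjective.injective_comp_right
  rw [← Finset.card_image_of_injective S hinj, ← Equiv.prod_comp Fin.revPerm M]
  refine card_le_prod_of_prefixFiber _ _ fun i p hp => ?_
  obtain ⟨q, hq, rfl⟩ := Finset.mem_image.1 hp
  refine le_trans (Finset.card_le_card ?_) (h i.rev q hq)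
  intro b hb
  obtain ⟨x, hx, rfl⟩ := Finset.mem_image.1 hb
  obtain ⟨hx, hxp⟩ := Finset.mem_filter.1 hx
  obtain ⟨y, hy, rfl⟩ := Finset.mem_image.1 hx
  refine Finset.mem_image.2 ⟨y, Finset.mem_filter.2 ⟨hy, fun j hj => ?_⟩, rfl⟩
  simpa using hxp j.rev (by rwa [← Fin.rev_lt_rev, Fin.rev_rev])

end Fibers

/-! ### From the xor power to monochromatic rectangles of `f` -/

theorem exists_card_le_two_mul_card_filter (P : Finset X) (u : X → ℤˣ) :
    ∃ c, P.card ≤ 2 * (P.filter fun x => u x = c).card := by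
  have h := Finset.card_filter_add_card_filter_not (s := P) fun x => u x = 1
  have h2 : (P.filter fun x => ¬ u x = 1) = P.filter fun x => u x = -1 :=
    Finset.filter_congr fun x _ => by
      rcases Int.units_eq_one_or (u x) with h | h <;> rw [h] <;> decide
  rw [h2] at h
  by_cases hc : P.card ≤ 2 * (P.filter fun x => u x = 1).card
  · exact ⟨1, hc⟩
  · exact ⟨-1, by omega⟩

/-- If `f` is a sum `u x + v y` on a rectangle, then it is constant on a quarter of it. -/
theorem exists_monochromatic_of_sgn_eq_mul {f : X → Y → Bool} {P : Finset X} {Q : Finset Y}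
    {u : X → ℤˣ} {v : Y → ℤˣ} (h : ∀ x ∈ P, ∀ y ∈ Q, sgn (f x y) = u x * v y) :
    ∃ P' ⊆ P, ∃ Q' ⊆ Q, IsMonochromatic f (P' : Set X) (Q' : Set Y) ∧
      P.card * Q.card ≤ 4 * (P'.card * Q'.card) := by
  obtain ⟨c, hc⟩ := exists_card_le_two_mul_card_filter P u
  obtain ⟨d, hd⟩ := exists_card_le_two_mul_card_filter Q v
  refine ⟨_, Finset.filter_subset _ _, _, Finset.filter_subset _ _, ?_,
    (Nat.mul_le_mul hc hd).trans_eq (by ring)⟩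
  have hval : ∀ x ∈ P.filter (fun x => u x = c), ∀ y ∈ Q.filter (fun y => v y = d),
      sgn (f x y) = c * d := by
    intro x hx y hy
    rw [Finset.mem_filter] at hx hy
    rw [h x hx.1 y hy.1, hx.2, hy.2]
  -- If no bit had this sign, the rectangle would be empty and any value would do.
  by_cases hz : ∃ z, sgn z = c * d
  · obtain ⟨z, hz⟩ := hz
    exact ⟨z, fun x hx y hy => sgn_injective ((hval x hx y hy).trans hz.symm)⟩
  · exact ⟨true, fun x hx y hy => absurd ⟨_, hval x hx y hy⟩ hz⟩

/-- On a monochromatic rectangle of `xorPow f n`, after fixing Alice's coordinates before `i` and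
Bob's coordinates after `i`, the value `f (x i) (y i)` is a function of `x i` plus one of `y i`. -/
theorem exists_monochromatic_of_fibers [DecidableEq X] [DecidableEq Y] {f : X → Y → Bool} {n : ℕ}
    {S : Finset (Fin n → X)} {T : Finset (Fin n → Y)}
    (h : IsMonochromatic (xorPow f n) (S : Set (Fin n → X)) (T : Set (Fin n → Y)))
    (i : Fin n) (p : Fin n → X) (s : Fin n → Y) :
    ∃ P' ⊆ prefixFiber S i p, ∃ Q' ⊆ suffixFiber T i s,
      IsMonochromatic f (P' : Set X) (Q' : Set Y) ∧
      (prefixFiber S i p).card * (suffixFiber T i s).card ≤ 4 * (P'.card * Q'.card) := by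
  obtain ⟨z, hz⟩ := h
  have hS : ∀ a : X, ∃ x : Fin n → X, a ∈ prefixFiber S i p →
      x ∈ S ∧ (∀ j < i, x j = p j) ∧ x i = a := by
    intro a
    by_cases ha : a ∈ prefixFiber S i p
    · obtain ⟨x, hx, rfl⟩ := Finset.mem_image.1 ha
      rw [Finset.mem_filter] at hx
      exact ⟨x, fun _ => ⟨hx.1, hx.2, rfl⟩⟩
    · exact ⟨p, fun h => absurd h ha⟩
  have hT : ∀ b : Y, ∃ y : Fin n → Y, b ∈ suffixFiber T i s →
      y ∈ T ∧ (∀ j, i < j → y j = s j) ∧ y i = b := by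
    intro b
    by_cases hb : b ∈ suffixFiber T i s
    · obtain ⟨y, hy, rfl⟩ := Finset.mem_image.1 hb
      rw [Finset.mem_filter] at hy
      exact ⟨y, fun _ => ⟨hy.1, hy.2, rfl⟩⟩
    · exact ⟨s, fun h => absurd h hb⟩
  choose α hα using hS
  choose β hβ using hT
  -- Evaluate the xor at `(α a, β b)` and solve for term `i`: terms `j < i` see only `p j` and `β
  -- b`, terms `j > i` only `α a` and `s j`.
  refine exists_monochromatic_of_sgn_eq_mul
    (u := fun a => sgn z * (∏ j ∈ Finset.univ.filter (fun j => i < j), sgn (f (α a j) (s j)))⁻¹)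
    (v := fun b => (∏ j ∈ Finset.univ.filter (fun j => j < i), sgn (f (p j) (β b j)))⁻¹) ?_
  intro a ha b hb
  obtain ⟨haS, hap, hai⟩ := hα a ha
  obtain ⟨hbT, hbs, hbi⟩ := hβ b hb
  have hprod := sgn_xorPow f (α a) (β b)
  rw [hz _ haS _ hbT, ← Finset.mul_prod_erase _ _ (Finset.mem_univ i), hai, hbi] at hprod
  have hsplit : Finset.univ.erase i =
      Finset.univ.filter (fun j => j < i) ∪ Finset.univ.filter (fun j => i < j) := by
    ext j
    simp [lt_or_lt_iff_ne]
  have hdisj : Disjoint (Finset.univ.filter fun j => j < i)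
      (Finset.univ.filter fun j => i < j) :=
    Finset.disjoint_filter.2 fun j _ h1 h2 => lt_asymm h1 h2
  have hlt : ∏ j ∈ Finset.univ.filter (fun j => j < i), sgn (f (α a j) (β b j)) =
      ∏ j ∈ Finset.univ.filter (fun j => j < i), sgn (f (p j) (β b j)) :=
    Finset.prod_congr rfl fun j hj => by rw [hap j (Finset.mem_filter.1 hj).2]
  have hgt : ∏ j ∈ Finset.univ.filter (fun j => i < j), sgn (f (α a j) (β b j)) =
      ∏ j ∈ Finset.univ.filter (fun j => i < j), sgn (f (α a j) (s j)) :=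
    Finset.prod_congr rfl fun j hj => by rw [hbs j (Finset.mem_filter.1 hj).2]
  rw [hsplit, Finset.prod_union hdisj, hlt, hgt] at hprod
  simp only [hprod]
  rw [← div_eq_mul_inv, ← div_eq_mul_inv, eq_div_iff_mul_eq', eq_div_iff_mul_eq']
  ac_rfl

/-- A rectangle of density at least `1 / Δ ^ n` in `A ^ n × B ^ n` that is monochromatic for
`xorPow f n` gives a rectangle of density at least `1 / (4 * Δ)` in `A × B` that is monochromatic
for `f`. -/
theorem exists_monochromatic_of_xorPow {f : X → Y → Bool} {n Δ : ℕ} (hn : n ≠ 0)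
    {A : Finset X} {B : Finset Y} (hA : A.Nonempty) (hB : B.Nonempty)
    {S : Finset (Fin n → X)} {T : Finset (Fin n → Y)}
    (hSA : ∀ x ∈ S, ∀ i, x i ∈ A) (hTB : ∀ y ∈ T, ∀ i, y i ∈ B)
    (h : IsMonochromatic (xorPow f n) (S : Set (Fin n → X)) (T : Set (Fin n → Y)))
    (hST : (A.card * B.card) ^ n ≤ Δ ^ n * (S.card * T.card)) :
    ∃ A' ⊆ A, ∃ B' ⊆ B, IsMonochromatic f (A' : Set X) (B' : Set Y) ∧
      A.card * B.card ≤ 4 * Δ * (A'.card * B'.card) := by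
  classical
  by_contra! hcon
  have hpos : 0 < A.card * B.card := Nat.mul_pos hA.card_pos hB.card_pos
  have hSTpos : 0 < S.card * T.card := by
    by_contra! h0
    have h1 : 0 < (A.card * B.card) ^ n := pow_pos hpos n
    rw [Nat.le_zero.1 h0, mul_zero] at hST
    omega
  have hS : S.Nonempty := Finset.card_pos.1 (Nat.pos_of_mul_pos_right hSTpos)
  have hT : T.Nonempty := Finset.card_pos.1 (Nat.pos_of_mul_pos_left hSTpos)
  -- The largest fibres supply the bounds `M i`; they may come from different prefixes and suffixes
  -- for different `i`.
  choose p hp hpM using fun i => S.exists_max_image (fun x => (prefixFiber S i x).card) hS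
  choose s hs hsM using fun i => T.exists_max_image (fun y => (suffixFiber T i y).card) hT
  have h1 := card_le_prod_of_prefixFiber S _ hpM
  have h2 := card_le_prod_of_suffixFiber T _ hsM
  have h3 (i : Fin n) : Δ * ((prefixFiber S i (p i)).card * (suffixFiber T i (s i)).card) ≤
      A.card * B.card - 1 := by
    obtain ⟨P', hP', Q', hQ', hm, hc⟩ := exists_monochromatic_of_fibers h i (p i) (s i)
    have hPA : P' ⊆ A := hP'.trans fun a ha => by
      obtain ⟨x, hx, rfl⟩ := Finset.mem_image.1 ha
      exact hSA x (Finset.mem_filter.1 hx).1 i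
    have hQB : Q' ⊆ B := hQ'.trans fun b hb => by
      obtain ⟨y, hy, rfl⟩ := Finset.mem_image.1 hb
      exact hTB y (Finset.mem_filter.1 hy).1 i
    have h4 := hcon P' hPA Q' hQB hm
    have h5 := Nat.mul_le_mul_left Δ hc
    have h6 : Δ * (4 * (P'.card * Q'.card)) = 4 * Δ * (P'.card * Q'.card) := by ring
    omega
  have h4 : Δ ^ n * (S.card * T.card) ≤ (A.card * B.card - 1) ^ n := by
    calc Δ ^ n * (S.card * T.card)
        ≤ Δ ^ n * ((∏ i, (prefixFiber S i (p i)).card) * ∏ i, (suffixFiber T i (s i)).card) := by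
          gcongr
      _ = ∏ i, Δ * ((prefixFiber S i (p i)).card * (suffixFiber T i (s i)).card) := by
          simp [Finset.prod_mul_distrib]
      _ ≤ ∏ _i : Fin n, (A.card * B.card - 1) := Finset.prod_le_prod' fun i _ => h3 i
      _ = (A.card * B.card - 1) ^ n := by simp
  have h5 : (A.card * B.card - 1) ^ n < (A.card * B.card) ^ n :=
    Nat.pow_lt_pow_left (by omega) hn
  omega

/-- If few monochromatic rectangles cover `xorPow f n`, every rectangle contains a large
rectangle that is monochromatic for `f`. -/
theorem exists_monochromatic_of_C_xorPow_le [Finite X] {f : X → Y → Bool} {n Δ : ℕ} (hn : n ≠ 0)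
    (hC : C (xorPow f n) ≤ Δ ^ n) {A : Finset X} {B : Finset Y} (hA : A.Nonempty)
    (hB : B.Nonempty) :
    ∃ A' ⊆ A, ∃ B' ⊆ B, IsMonochromatic f (A' : Set X) (B' : Set Y) ∧
      A.card * B.card ≤ 4 * Δ * (A'.card * B'.card) := by
  classical
  obtain ⟨U, V, hm, hc⟩ := exists_cover_of_C (xorPow f n)
  set As := Fintype.piFinset fun _ : Fin n => A with hAs
  set Bs := Fintype.piFinset fun _ : Fin n => B with hBs
  -- Averaging: at most `Δ ^ n` rectangles cover `A ^ n × B ^ n`.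
  obtain ⟨i, hi⟩ : ∃ i, (A.card * B.card) ^ n ≤
      Δ ^ n * ((As.filter (· ∈ U i)).card * (Bs.filter (· ∈ V i)).card) := by
    by_contra! hcon
    have hpos : 0 < (A.card * B.card) ^ n :=
      pow_pos (Nat.mul_pos hA.card_pos hB.card_pos) n
    have hcover : As ×ˢ Bs ⊆ Finset.univ.biUnion fun i =>
        (As.filter (· ∈ U i)) ×ˢ (Bs.filter (· ∈ V i)) := by
      rintro ⟨x, y⟩ hxy
      obtain ⟨i, hi⟩ := hc x y
      rw [Finset.mem_product] at hxy
      simp only [Finset.mem_biUnion, Finset.mem_univ, true_and, Finset.mem_product,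
        Finset.mem_filter]
      exact ⟨i, ⟨hxy.1, hi.1⟩, hxy.2, hi.2⟩
    have h1 := (Finset.card_le_card hcover).trans Finset.card_biUnion_le
    have h2 : (As ×ˢ Bs).card = (A.card * B.card) ^ n := by
      simp [hAs, hBs, mul_pow]
    rw [h2] at h1
    have h3 : Δ ^ n * (A.card * B.card) ^ n ≤ C (xorPow f n) * ((A.card * B.card) ^ n - 1) := by
      calc _ ≤ Δ ^ n * ∑ i, ((As.filter (· ∈ U i)) ×ˢ (Bs.filter (· ∈ V i))).card := by gcongr
        _ = ∑ i, Δ ^ n * ((As.filter (· ∈ U i)).card * (Bs.filter (· ∈ V i)).card) := by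
          simp [Finset.mul_sum]
        _ ≤ ∑ _i : Fin (C (xorPow f n)), ((A.card * B.card) ^ n - 1) :=
          Finset.sum_le_sum fun i _ => Nat.le_pred_of_lt (hcon i)
        _ = _ := by simp
    have hCpos : 0 < C (xorPow f n) := by
      obtain ⟨a, -⟩ := hA
      obtain ⟨b, -⟩ := hB
      exact (hc (fun _ => a) (fun _ => b)).choose.pos
    have h4 : C (xorPow f n) * ((A.card * B.card) ^ n - 1) < Δ ^ n * (A.card * B.card) ^ n :=
      Nat.mul_lt_mul_of_le_of_lt hC (by omega) (by omega)
    omega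
  refine exists_monochromatic_of_xorPow hn hA hB (fun x hx j => ?_) (fun y hy j => ?_) ?_ hi
  · exact Fintype.mem_piFinset.1 (Finset.mem_filter.1 hx).1 j
  · exact Fintype.mem_piFinset.1 (Finset.mem_filter.1 hy).1 j
  · obtain ⟨z, hz⟩ := hm i
    exact ⟨z, fun x hx y hy => hz x (Finset.mem_filter.1 hx).2 y (Finset.mem_filter.1 hy).2⟩

/-! ### Ranks of rectangles -/

/-- The dimension lost under `φ` is that of the intersection with `ker φ`, which is monotone in the
subspace. For row spaces and column restriction this is submodularity of rank. -/
theorem finrank_add_finrank_map_le {V V' : Type*} [AddCommGroup V] [Module ℝ V]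
    [FiniteDimensional ℝ V] [AddCommGroup V'] [Module ℝ V'] (φ : V →ₗ[ℝ] V')
    {W' W : Submodule ℝ V} (h : W' ≤ W) :
    finrank ℝ W' + finrank ℝ (W.map φ) ≤ finrank ℝ W + finrank ℝ (W'.map φ) := by
  have key (U : Submodule ℝ V) :
      finrank ℝ (U.map φ) + finrank ℝ (U ⊓ LinearMap.ker φ : Submodule ℝ V) = finrank ℝ U := by
    rw [← LinearMap.finrank_range_add_finrank_ker (φ.domRestrict U), LinearMap.range_domRestrict,
      LinearMap.ker_domRestrict, ← Submodule.map_comap_subtype, Submodule.finrank_map_subtype_eq]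
  have h1 : finrank ℝ (W' ⊓ LinearMap.ker φ : Submodule ℝ V) ≤
      finrank ℝ (W ⊓ LinearMap.ker φ : Submodule ℝ V) :=
    Submodule.finrank_mono (inf_le_inf_right _ h)
  have := key W
  have := key W'
  omega

/-- The row of `x` in the sign matrix of `f`. -/
def row (f : X → Y → Bool) (x : X) : Y → ℝ := fun y => (-1) ^ (f x y).toNat

theorem neg_one_pow_toNat_injective : Function.Injective fun b : Bool => (-1 : ℝ) ^ b.toNat := by
  intro a b h
  cases a <;> cases b <;> first | rfl | norm_num at h

open Classical in
/-- The linear map that replaces the coordinates outside `B` by zero. -/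
noncomputable def restrictTo (B : Finset Y) : (Y → ℝ) →ₗ[ℝ] (Y → ℝ) where
  toFun v y := if y ∈ B then v y else 0
  map_add' u v := by
    funext y
    by_cases h : y ∈ B <;> simp [h]
  map_smul' c v := by
    funext y
    by_cases h : y ∈ B <;> simp [h]

theorem restrictTo_apply_of_mem {B : Finset Y} {y : Y} (h : y ∈ B) (v : Y → ℝ) :
    restrictTo B v y = v y := by
  simp [restrictTo, h]

theorem restrictTo_apply_of_notMem {B : Finset Y} {y : Y} (h : y ∉ B) (v : Y → ℝ) :
    restrictTo B v y = 0 := by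
  simp [restrictTo, h]

theorem restrictTo_comp_restrictTo {B' B : Finset Y} (h : B' ⊆ B) :
    restrictTo B' ∘ₗ restrictTo B = restrictTo B' := by
  ext v y
  by_cases hy : y ∈ B'
  · simp [restrictTo_apply_of_mem, hy, h hy]
  · simp [restrictTo_apply_of_notMem, hy]

/-- The row space of the restriction of the sign matrix of `f` to `A × B`. -/
noncomputable def rowSpace (f : X → Y → Bool) (A : Finset X) (B : Finset Y) :
    Submodule ℝ (Y → ℝ) :=
  (Submodule.span ℝ (row f '' A)).map (restrictTo B)

theorem map_restrictTo_rowSpace (f : X → Y → Bool) (A : Finset X) {B' B : Finset Y}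
    (h : B' ⊆ B) : (rowSpace f A B).map (restrictTo B') = rowSpace f A B' := by
  rw [rowSpace, ← Submodule.map_comp, restrictTo_comp_restrictTo h, rowSpace]

theorem rowSpace_mono (f : X → Y → Bool) {A' A : Finset X} (h : A' ⊆ A) (B : Finset Y) :
    rowSpace f A' B ≤ rowSpace f A B :=
  Submodule.map_mono (Submodule.span_mono (Set.image_mono (by exact_mod_cast h)))

theorem restrictTo_row_mem_rowSpace (f : X → Y → Bool) {A : Finset X} {x : X} (hx : x ∈ A)
    (B : Finset Y) : restrictTo B (row f x) ∈ rowSpace f A B :=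
  Submodule.mem_map_of_mem (Submodule.subset_span ⟨x, hx, rfl⟩)

/-- The rank of the restriction of the sign matrix of `f` to `A × B`. -/
noncomputable def rectRank (f : X → Y → Bool) (A : Finset X) (B : Finset Y) : ℕ :=
  finrank ℝ (rowSpace f A B)

theorem rectRank_le_one_of_isMonochromatic {f : X → Y → Bool} {A : Finset X} {B : Finset Y}
    (h : IsMonochromatic f (A : Set X) (B : Set Y)) : rectRank f A B ≤ 1 := by
  obtain ⟨z, hz⟩ := h
  have hle : rowSpace f A B ≤
      Submodule.span ℝ {restrictTo B (fun _ => (-1 : ℝ) ^ z.toNat)} := by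
    rw [rowSpace, Submodule.map_span, Submodule.span_le]
    rintro _ ⟨_, ⟨x, hx, rfl⟩, rfl⟩
    refine Submodule.subset_span ?_
    rw [Set.mem_singleton_iff]
    ext y
    by_cases hy : y ∈ B
    · simp [restrictTo_apply_of_mem, hy, row, hz x hx y hy]
    · simp [restrictTo_apply_of_notMem, hy]
  exact (Submodule.finrank_mono hle).trans
    ((finrank_span_le_card _).trans (by simp))

section Rank

variable [Fintype Y]

theorem rectRank_mono_left (f : X → Y → Bool) {A' A : Finset X} (h : A' ⊆ A) (B : Finset Y) :
    rectRank f A' B ≤ rectRank f A B :=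
  Submodule.finrank_mono (rowSpace_mono f h B)

theorem rectRank_mono_right (f : X → Y → Bool) (A : Finset X) {B' B : Finset Y} (h : B' ⊆ B) :
    rectRank f A B' ≤ rectRank f A B := by
  rw [rectRank, ← map_restrictTo_rowSpace f A h]
  exact Submodule.finrank_map_le _ _

theorem rectRank_le_rk [Finite X] (f : X → Y → Bool) (A : Finset X) (B : Finset Y) :
    rectRank f A B ≤ rk f := by
  rw [rk, Matrix.rank_eq_finrank_span_row]
  exact (Submodule.finrank_map_le _ _).trans
    (Submodule.finrank_mono (Submodule.span_mono (Set.image_subset_range _ _)))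

/-- The two strips through a monochromatic rectangle together have small rank. -/
theorem rectRank_add_rectRank_le {f : X → Y → Bool} {A' A : Finset X} {B' B : Finset Y}
    (hA : A' ⊆ A) (hB : B' ⊆ B) (h : IsMonochromatic f (A' : Set X) (B' : Set Y)) :
    rectRank f A' B + rectRank f A B' ≤ rectRank f A B + 1 := by
  have h1 := finrank_add_finrank_map_le (restrictTo B') (rowSpace_mono f hA B)
  rw [map_restrictTo_rowSpace f A hB, map_restrictTo_rowSpace f A' hB] at h1
  exact h1.trans (Nat.add_le_add_left (rectRank_le_one_of_isMonochromatic h) _)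

/-- All rows are multiples of one vector, so every 2 × 2 minor vanishes; for signs this is a parity
identity. -/
theorem xor_eq_xor_of_rectRank_le_one {f : X → Y → Bool} {A : Finset X} {B : Finset Y}
    (h : rectRank f A B ≤ 1) {x x₀ : X} {y y₀ : Y} (hx : x ∈ A) (hx₀ : x₀ ∈ A) (hy : y ∈ B)
    (hy₀ : y₀ ∈ B) : f x y = xor (xor (f x y₀) (f x₀ y₀)) (f x₀ y) := by
  obtain ⟨v, hv⟩ := finrank_le_one_iff.1 h
  obtain ⟨c, hc⟩ := hv ⟨_, restrictTo_row_mem_rowSpace f hx B⟩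
  obtain ⟨d, hd⟩ := hv ⟨_, restrictTo_row_mem_rowSpace f hx₀ B⟩
  have hc' (w : Y) (hw : w ∈ B) : c * v.1 w = row f x w := by
    exact (congrFun (congrArg Subtype.val hc) w).trans (restrictTo_apply_of_mem hw _)
  have hd' (w : Y) (hw : w ∈ B) : d * v.1 w = row f x₀ w := by
    exact (congrFun (congrArg Subtype.val hd) w).trans (restrictTo_apply_of_mem hw _)
  have key : row f x y * row f x₀ y₀ = row f x y₀ * row f x₀ y := by
    rw [← hc' y hy, ← hc' y₀ hy₀, ← hd' y hy, ← hd' y₀ hy₀]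
    ring
  simp only [row] at key
  revert key
  cases f x y <;> cases f x y₀ <;> cases f x₀ y <;> cases f x₀ y₀ <;> norm_num

/-- Choose a basis of the column space among the columns. If two rows agree there, the difference of
the two coordinate functionals kills the whole span. -/
theorem exists_columns_determine_rows [Fintype X] (f : X → Y → Bool) :
    ∃ c : Fin (rk f) → Y, ∀ x x', (∀ j, f x (c j) = f x' (c j)) → f x = f x' := by
  have hrk : rk f = finrank ℝ (Submodule.span ℝ (Set.range fun y x => row f x y)) :=
    Matrix.rank_eq_finrank_span_cols _
  rw [hrk]
  obtain ⟨g, hg, hspan, -⟩ := Submodule.exists_fun_fin_finrank_span_eq ℝ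
    (Set.range fun y x => row f x y)
  choose c hc using hg
  refine ⟨c, fun x x' h => funext fun y => ?_⟩
  have hle : Submodule.span ℝ (Set.range g) ≤
      LinearMap.ker (LinearMap.proj (R := ℝ) (φ := fun _ : X => ℝ) x - LinearMap.proj x') := by
    rw [Submodule.span_le]
    rintro _ ⟨j, rfl⟩
    rw [← hc j]
    simp [row, h j]
  have hy := hle (hspan.ge (Submodule.subset_span (Set.mem_range_self y)))
  rw [LinearMap.mem_ker, LinearMap.sub_apply, sub_eq_zero] at hy
  exact neg_one_pow_toNat_injective hy

/-- A sign matrix of rank `r` has at most `2 ^ r` different rows. -/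
theorem exists_row_representatives [Fintype X] (f : X → Y → Bool) :
    ∃ (A : Finset X) (φ : X → X), A.card ≤ 2 ^ rk f ∧ (∀ x, φ x ∈ A) ∧ ∀ x, f (φ x) = f x := by
  classical
  obtain ⟨c, hc⟩ := exists_columns_determine_rows f
  let code : X → Fin (rk f) → Bool := fun x j => f x (c j)
  refine ⟨(Finset.univ : Finset (Set.range code)).image fun b => b.2.choose,
    fun x => (⟨x, rfl⟩ : code x ∈ Set.range code).choose, ?_, fun x => ?_, fun x => ?_⟩
  · refine Finset.card_image_le.trans ?_
    rw [Finset.card_univ]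
    exact (Fintype.card_subtype_le _).trans (by simp)
  · exact Finset.mem_image.2 ⟨⟨code x, x, rfl⟩, Finset.mem_univ _, rfl⟩
  · exact hc _ _ fun j =>
      congrFun (⟨x, rfl⟩ : code x ∈ Set.range code).choose_spec j

theorem rk_flip [Fintype X] (f : X → Y → Bool) : rk (flip f) = rk f :=
  Matrix.rank_transpose (Matrix.of fun x y => (-1 : ℝ) ^ (f x y).toNat)

end Rank

/-! ### Protocols from low rank and large monochromatic rectangles -/

open Protocol in
theorem exists_protocol_of_rectRank_le_one [Fintype Y] {f : X → Y → Bool} {A : Finset X} {B : Finset Y}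
    (h : rectRank f A B ≤ 1) :
    ∃ p : Protocol X Y Bool, p.leaves ≤ 4 ∧ ∀ x ∈ A, ∀ y ∈ B, p.run x y = f x y := by
  obtain rfl | ⟨x₀, hx₀⟩ := A.eq_empty_or_nonempty
  · exact ⟨leaf true, by simp [leaves], by simp⟩
  obtain rfl | ⟨y₀, hy₀⟩ := B.eq_empty_or_nonempty
  · exact ⟨leaf true, by simp [leaves], by simp⟩
  refine ⟨alice (fun x => xor (f x y₀) (f x₀ y₀)) (bob (f x₀) (leaf false) (leaf true))
    (bob (f x₀) (leaf true) (leaf false)), by simp [leaves], fun x hx y hy => ?_⟩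
  rw [xor_eq_xor_of_rectRank_le_one h hx hx₀ hy hy₀]
  cases h₁ : xor (f x y₀) (f x₀ y₀) <;> cases h₂ : f x₀ y <;> simp [run, h₁, h₂]

/-- The leaf bound `L t w = 4 * (w + 1) ^ t` satisfies the recursion `L t (w + 1) + L (t + 1) w ≤ L
(t + 1) (w + 1)` of the protocol below. -/
theorem add_pow_le_succ_pow (t w : ℕ) :
    4 * (w + 1 + 1) ^ t + 4 * (w + 1) ^ (t + 1) ≤ 4 * (w + 1 + 1) ^ (t + 1) := by
  have h : (w + 1) ^ t ≤ (w + 1 + 1) ^ t := Nat.pow_le_pow_left (by omega) t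
  have h' := Nat.mul_le_mul_right (w + 1) h
  rw [pow_succ, pow_succ]
  linarith

theorem card_sdiff_mul_le {α β : Type*} [DecidableEq α] {A' A : Finset α} {B' B : Finset β}
    {Δ : ℕ} (hΔ : 0 < Δ) (hA : A' ⊆ A) (hB : B' ⊆ B)
    (h : A.card * B.card ≤ Δ * (A'.card * B'.card)) :
    (((A \ A').card * B.card : ℕ) : ℝ) ≤ ((A.card * B.card : ℕ) : ℝ) * (1 - 1 / Δ) := by
  have hΔ' : (0 : ℝ) < Δ := by exact_mod_cast hΔ
  have h1 : (A.card * B.card : ℝ) ≤ Δ * (A'.card * B.card) := by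
    have := h.trans (Nat.mul_le_mul_left Δ (Nat.mul_le_mul_left _ (Finset.card_le_card hB)))
    exact_mod_cast this
  have h2 : (A.card * B.card : ℝ) / Δ ≤ A'.card * B.card := by
    rw [div_le_iff₀ hΔ']
    linarith
  rw [Finset.card_sdiff_of_subset hA, Nat.cast_mul, Nat.cast_sub (Finset.card_le_card hA),
    Nat.cast_mul]
  calc ((A.card : ℝ) - A'.card) * B.card = A.card * B.card - A'.card * B.card := by ring
    _ ≤ A.card * B.card - A.card * B.card / Δ := by linarith
    _ = _ := by ring

open Protocol in
/-- If every rectangle has a monochromatic rectangle of density at least `1 / Δ`, then low rank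
gives protocols with few leaves. -/
theorem exists_protocol_of_rectRank_le [Fintype Y] {f : X → Y → Bool} {Δ : ℕ} (hΔ : 0 < Δ)
    (hmono : ∀ (A : Finset X) (B : Finset Y), A.Nonempty → B.Nonempty →
      ∃ A' ⊆ A, ∃ B' ⊆ B, IsMonochromatic f (A' : Set X) (B' : Set Y) ∧
        A.card * B.card ≤ Δ * (A'.card * B'.card))
    (t w : ℕ) (A : Finset X) (B : Finset Y) (hr : rectRank f A B ≤ 2 ^ t)
    (hw : ((A.card * B.card : ℕ) : ℝ) * (1 - 1 / Δ) ^ w < 1) :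
    ∃ p : Protocol X Y Bool, p.leaves ≤ 4 * (w + 1) ^ t ∧
      ∀ x ∈ A, ∀ y ∈ B, p.run x y = f x y := by
  classical
  have hδ : (0 : ℝ) ≤ 1 - 1 / Δ := by
    have : (1 : ℝ) ≤ Δ := by exact_mod_cast hΔ
    have : (1 : ℝ) / Δ ≤ 1 := by rw [div_le_one (by linarith)]; exact this
    linarith
  -- `t` counts rank halvings and `w` area shrinkings: entering the strip lowers `t`, leaving it
  -- lowers `w`. At `w = 0` the area is below 1, so the rectangle is empty.
  induction t generalizing w A B with
  | zero => simpa using exists_protocol_of_rectRank_le_one (by simpa using hr)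
  | succ t iht =>
    induction w generalizing A B with
    | zero =>
      rw [pow_zero, mul_one] at hw
      have h0 : A.card * B.card = 0 := by
        have : A.card * B.card < 1 := by exact_mod_cast hw
        omega
      refine ⟨leaf true, by simp [leaves], fun x hx y hy => ?_⟩
      rcases Nat.mul_eq_zero.1 h0 with h | h
      · simp [Finset.card_eq_zero.1 h] at hx
      · simp [Finset.card_eq_zero.1 h] at hy
    | succ w ihw =>
      obtain hA | hA := A.eq_empty_or_nonempty
      · exact ⟨leaf true, by simpa [leaves] using Nat.one_le_iff_ne_zero.2 (by positivity),
          by simp [hA]⟩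
      obtain hB | hB := B.eq_empty_or_nonempty
      · exact ⟨leaf true, by simpa [leaves] using Nat.one_le_iff_ne_zero.2 (by positivity),
          by simp [hB]⟩
      obtain ⟨A', hA', B', hB', hm, hc⟩ := hmono A B hA hB
      have hstrip := rectRank_add_rectRank_le hA' hB' hm
      have hsub {a b : ℕ} (hab : (a : ℝ) ≤ b)
          (h : (b : ℝ) * (1 - 1 / Δ) ^ (w + 1) < 1) : (a : ℝ) * (1 - 1 / Δ) ^ (w + 1) < 1 :=
        lt_of_le_of_lt (mul_le_mul_of_nonneg_right hab (pow_nonneg hδ _)) h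
      have hdrop {a : ℕ} (ha : (a : ℝ) ≤ ((A.card * B.card : ℕ) : ℝ) * (1 - 1 / Δ)) :
          (a : ℝ) * (1 - 1 / Δ) ^ w < 1 := by
        refine lt_of_le_of_lt (mul_le_mul_of_nonneg_right ha (pow_nonneg hδ _)) ?_
        rwa [mul_assoc, ← pow_succ']
      have hleaves := add_pow_le_succ_pow t w
      by_cases hcase : rectRank f A' B ≤ 2 ^ t
      · obtain ⟨p₁, hp₁, hrun₁⟩ := iht (w + 1) A' B hcase
          (hsub (by exact_mod_cast Nat.mul_le_mul_right _ (Finset.card_le_card hA')) hw)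
        obtain ⟨p₀, hp₀, hrun₀⟩ := ihw (A \ A') B
          ((rectRank_mono_left f Finset.sdiff_subset B).trans hr)
          (hdrop (card_sdiff_mul_le hΔ hA' hB' hc))
        refine ⟨alice (fun x => decide (x ∈ A')) p₀ p₁, by simp only [leaves]; omega,
          fun x hx y hy => ?_⟩
        by_cases hx' : x ∈ A'
        · simp [run, hx', hrun₁ x hx' y hy]
        · simp [run, hx', hrun₀ x (Finset.mem_sdiff.2 ⟨hx, hx'⟩) y hy]
      · have hcase' : rectRank f A B' ≤ 2 ^ t := by
          rw [pow_succ] at hr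
          omega
        obtain ⟨p₁, hp₁, hrun₁⟩ := iht (w + 1) A B' hcase'
          (hsub (by exact_mod_cast Nat.mul_le_mul_left _ (Finset.card_le_card hB')) hw)
        have hc' : B.card * A.card ≤ Δ * (B'.card * A'.card) := by
          rwa [mul_comm B.card, mul_comm B'.card]
        have hdiff := card_sdiff_mul_le hΔ hB' hA' hc'
        rw [mul_comm _ A.card, mul_comm _ A.card] at hdiff
        obtain ⟨p₀, hp₀, hrun₀⟩ := ihw A (B \ B')
          ((rectRank_mono_right f A Finset.sdiff_subset).trans hr) (hdrop hdiff)
        refine ⟨bob (fun y => decide (y ∈ B')) p₀ p₁, by simp only [leaves]; omega,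
          fun x hx y hy => ?_⟩
        by_cases hy' : y ∈ B'
        · simp [run, hy', hrun₁ x hx y hy']
        · simp [run, hy', hrun₀ x hx y (Finset.mem_sdiff.2 ⟨hy, hy'⟩)]

/-- Since `(1 - 1 / Δ) ^ Δ ≤ exp (-1) < 1 / 2`, a total of `2 * r * Δ` shrinkings exhaust an area of
`4 ^ r`. -/
theorem four_pow_mul_one_sub_inv_pow_lt_one {r Δ : ℕ} (hr : 0 < r) (hΔ : 0 < Δ) :
    (4 : ℝ) ^ r * (1 - 1 / Δ) ^ (2 * r * Δ) < 1 := by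
  have hΔ' : (1 : ℝ) ≤ Δ := by exact_mod_cast hΔ
  have h0 : (0 : ℝ) ≤ 1 - 1 / Δ := by
    have : (1 : ℝ) / Δ ≤ 1 := by rw [div_le_one (by linarith)]; exact hΔ'
    linarith
  have h1 : (1 - 1 / Δ : ℝ) ^ Δ ≤ Real.exp (-1) := by
    calc (1 - 1 / Δ : ℝ) ^ Δ ≤ Real.exp (-(1 / Δ)) ^ Δ :=
          pow_le_pow_left₀ h0 (Real.one_sub_le_exp_neg _) _
      _ = Real.exp (-1) := by
          rw [← Real.exp_nat_mul]
          congr 1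
          field_simp
  have h2 : Real.exp (-1) < 1 / 2 := by
    have := Real.exp_neg_one_lt_half
    linarith
  have h3 : (1 - 1 / Δ : ℝ) ^ Δ < 1 / 2 := lt_of_le_of_lt h1 h2
  have h4 : (4 : ℝ) * ((1 - 1 / Δ : ℝ) ^ Δ) ^ 2 < 1 := by
    have := pow_nonneg h0 Δ
    nlinarith
  calc (4 : ℝ) ^ r * (1 - 1 / Δ) ^ (2 * r * Δ) = (4 * ((1 - 1 / Δ : ℝ) ^ Δ) ^ 2) ^ r := by
        rw [mul_pow, ← pow_mul, ← pow_mul]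
        ring_nf
    _ < 1 := pow_lt_one₀ (by positivity) h4 hr.ne'

/-- If every rectangle has a monochromatic rectangle of density at least `2 ^ (-κ)` and the rank
is at most `2 ^ t`, then the communication complexity is `O(t * (t + κ))`. -/
theorem D_le_of_exists_monochromatic [Fintype X] [Fintype Y] {f : X → Y → Bool} {κ t : ℕ}
    (hr : 0 < rk f) (ht : rk f ≤ 2 ^ t)
    (hmono : ∀ (A : Finset X) (B : Finset Y), A.Nonempty → B.Nonempty →
      ∃ A' ⊆ A, ∃ B' ⊆ B, IsMonochromatic f (A' : Set X) (B' : Set Y) ∧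
        A.card * B.card ≤ 2 ^ κ * (A'.card * B'.card)) :
    D f ≤ 6 * (2 + (t + κ + 2) * t) + 5 := by
  -- Merging equal rows and equal columns bounds the initial area in terms of the rank alone.
  obtain ⟨A, φ, hAcard, hφA, hφ⟩ := exists_row_representatives f
  obtain ⟨B, ψ, hBcard, hψB, hψ⟩ := exists_row_representatives (flip f)
  rw [rk_flip] at hBcard
  have hAB : ((A.card * B.card : ℕ) : ℝ) ≤ 4 ^ rk f := by
    have : A.card * B.card ≤ 4 ^ rk f :=
      (Nat.mul_le_mul hAcard hBcard).trans_eq (by rw [← mul_pow]; norm_num)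
    exact_mod_cast this
  have hδ : (0 : ℝ) ≤ 1 - 1 / (2 ^ κ : ℕ) := by
    have h1 : (1 : ℝ) ≤ (2 ^ κ : ℕ) := by exact_mod_cast Nat.one_le_two_pow
    have : (1 : ℝ) / (2 ^ κ : ℕ) ≤ 1 := by rw [div_le_one (by linarith)]; exact h1
    linarith
  obtain ⟨p, hp, hrun⟩ := exists_protocol_of_rectRank_le (f := f) (Nat.two_pow_pos κ) hmono t
    (2 * rk f * 2 ^ κ) A B ((rectRank_le_rk f A B).trans ht)
    (lt_of_le_of_lt (mul_le_mul_of_nonneg_right hAB (pow_nonneg hδ _))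
      (four_pow_mul_one_sub_inv_pow_lt_one hr (Nat.two_pow_pos κ)))
  have hleaves : p.leaves ≤ 2 ^ (2 + (t + κ + 2) * t) := by
    have h1 : 2 * rk f * 2 ^ κ + 1 ≤ 2 ^ (t + κ + 2) := by
      have h2 := Nat.mul_le_mul_right (2 ^ κ) ht
      have h3 : 0 < 2 ^ t * 2 ^ κ := by positivity
      rw [pow_add, pow_add]
      linarith
    calc p.leaves ≤ 4 * (2 * rk f * 2 ^ κ + 1) ^ t := hp
      _ ≤ 4 * (2 ^ (t + κ + 2)) ^ t := by gcongr
      _ = 2 ^ (2 + (t + κ + 2) * t) := by rw [← pow_mul, pow_add]; norm_num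
  obtain ⟨p', hp', hc⟩ := Protocol.exists_run_eq_of_leaves_le_two_pow _ (p.comap φ ψ)
    ((Protocol.leaves_comap φ ψ p).trans_le hleaves)
  refine (D_le_cost (p := p') fun x y => ?_).trans hc
  rw [hp', Protocol.run_comap, hrun _ (hφA x) _ (hψB y), hφ]
  exact congrFun (hψ y) x

/-! ### Assembling the bound -/

theorem D_le_of_C_xorPow_le [Fintype X] [Fintype Y] {f : X → Y → Bool} {n κ t : ℕ} (hn : n ≠ 0)
    (hr : 0 < rk f) (ht : rk f ≤ 2 ^ t) (hC : C (xorPow f n) ≤ (2 ^ κ) ^ n) :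
    D f ≤ 17 + 6 * (t * (t + κ + 4)) := by
  -- The extra 2 pays for the factor 4 lost in passing to a quarter.
  refine (D_le_of_exists_monochromatic (κ := κ + 2) hr ht fun A B hA hB => ?_).trans_eq (by ring)
  rw [pow_add, mul_comm (2 ^ κ)]
  exact exists_monochromatic_of_C_xorPow_le hn hC hA hB

theorem D_le_mul_logb_C_xorPow [Fintype X] [Fintype Y] {f : X → Y → Bool} {n : ℕ} (hn : n ≠ 0)
    (hr : 2 ≤ rk f) :
    (D f : ℝ) ≤ 101 * (Real.logb 2 (rk f) *
      (Real.logb 2 (rk f) + Real.logb 2 (C (xorPow f n)) / n)) := by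
  set l := Real.logb 2 (rk f) with hl_def
  set k := Real.logb 2 (C (xorPow f n)) / n with hk_def
  have hl : 1 ≤ l := by
    rw [hl_def, Real.le_logb_iff_rpow_le (by norm_num) (by positivity)]
    simpa using (show (2 : ℝ) ≤ rk f by exact_mod_cast hr)
  have hk : 0 ≤ k := by
    refine div_nonneg ?_ (Nat.cast_nonneg n)
    rcases Nat.eq_zero_or_pos (C (xorPow f n)) with h | h
    · simp [h]
    · exact Real.logb_nonneg (by norm_num) (by exact_mod_cast h)
  have ht : ((⌈l⌉₊ : ℕ) : ℝ) ≤ 2 * l := by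
    have := Nat.ceil_lt_add_one (zero_le_one.trans hl)
    linarith
  have hκ : ((⌈k⌉₊ : ℕ) : ℝ) ≤ k + 1 := (Nat.ceil_lt_add_one hk).le
  have hrk : rk f ≤ 2 ^ ⌈l⌉₊ := by
    have h : (rk f : ℝ) ≤ (2 : ℝ) ^ ((⌈l⌉₊ : ℕ) : ℝ) := by
      rw [← Real.logb_le_iff_le_rpow (by norm_num) (by positivity)]
      exact Nat.le_ceil l
    rw [Real.rpow_natCast] at h
    exact_mod_cast h
  have hC : C (xorPow f n) ≤ (2 ^ ⌈k⌉₊) ^ n := by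
    rcases Nat.eq_zero_or_pos (C (xorPow f n)) with h | h
    · simp [h]
    have h1 : (C (xorPow f n) : ℝ) ≤ (2 : ℝ) ^ ((⌈k⌉₊ * n : ℕ) : ℝ) := by
      rw [← Real.logb_le_iff_le_rpow (by norm_num) (by exact_mod_cast h), Nat.cast_mul,
        ← div_le_iff₀ (by exact_mod_cast Nat.pos_of_ne_zero hn)]
      exact Nat.le_ceil k
    rw [Real.rpow_natCast, pow_mul] at h1
    exact_mod_cast h1
  have hD : (D f : ℝ) ≤ 17 + 6 * (⌈l⌉₊ * (⌈l⌉₊ + ⌈k⌉₊ + 4)) := by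
    exact_mod_cast D_le_of_C_xorPow_le hn (by omega) hrk hC
  have h1 : ((⌈l⌉₊ : ℕ) : ℝ) * (⌈l⌉₊ + ⌈k⌉₊ + 4) ≤ (2 * l) * (2 * l + (k + 1) + 4) := by
    gcongr
  -- As `l ≥ 1`, `17 + 12 * l * (2 * l + k + 5) ≤ (17 + 24 + 60) * l ^ 2 + 12 * l * k`, whence 101.
  nlinarith [mul_nonneg (sub_nonneg.2 hl) (sub_nonneg.2 hl), mul_nonneg (zero_le_one.trans hl) hk]

end CommComplexity

theorem theorem1p3 :
    ∃ c : ℝ, 0 < c ∧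
      ∀ (X Y : Type*) [Fintype X] [Fintype Y] [Nonempty X] [Nonempty Y]
        (f : X → Y → Bool) (n : ℕ),
        Real.logb 2 (CommComplexity.C (CommComplexity.xorPow f n))
            ≤ (CommComplexity.D (CommComplexity.xorPow f n) : ℝ) ∧
          (2 ≤ CommComplexity.rk f →
            (n : ℝ) * (c * (CommComplexity.D f : ℝ) / Real.logb 2 (CommComplexity.rk f)
                - Real.logb 2 (CommComplexity.rk f))
              ≤ Real.logb 2 (CommComplexity.C (CommComplexity.xorPow f n))) := by
  refine ⟨1 / 101, by norm_num, fun X Y _ _ _ _ f n => ⟨?_, fun hr => ?_⟩⟩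
  -- At 0 the default `Real.logb 2 0 = 0` makes the bound trivial.
  · rcases Nat.eq_zero_or_pos (CommComplexity.C (CommComplexity.xorPow f n)) with h | h
    · simp [h]
    rw [Real.logb_le_iff_le_rpow (by norm_num) (by exact_mod_cast h), Real.rpow_natCast]
    exact_mod_cast CommComplexity.C_le_two_pow_D (CommComplexity.xorPow f n)
  · have hlogC : 0 ≤ Real.logb 2 (CommComplexity.C (CommComplexity.xorPow f n)) := by
      rcases Nat.eq_zero_or_pos (CommComplexity.C (CommComplexity.xorPow f n)) with h | h
      · simp [h]
      · exact Real.logb_nonneg (by norm_num) (by exact_mod_cast h)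
    rcases eq_or_ne n 0 with rfl | hn
    · simpa using hlogC
    have hl : 0 < Real.logb 2 (CommComplexity.rk f) :=
      Real.logb_pos (by norm_num) (by exact_mod_cast hr)
    have hn' : (0 : ℝ) < n := by exact_mod_cast Nat.pos_of_ne_zero hn
    have hD := CommComplexity.D_le_mul_logb_C_xorPow hn hr
    rw [mul_comm, ← le_div_iff₀ hn', sub_le_iff_le_add, div_le_iff₀ hl]
    linarith
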